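/- **Setting.** Let $\mathbb P$ be a set of propositional variables. A *propositional assignment* is a non-empty finite partial function $\alpha:\mathbb P\rightharpoonup\{\bot,\top\}$. Formulas and programs of DL-PA are given by $$\phi ::= p \mid \lnot\phi \mid \phi\land\phi \mid [\pi]\phi,\qquad \pi ::= \alpha \mid \pi;\pi \mid \pi\cup\pi \mid \pi^* \mid \phi?.$$ Write $\mathbb P_\phi$ for the set of variables occurring in $\phi$. Execution traces are sequences of assignments: $\mathrm{exe}(p)=\{()\}$, $\mathrm{exe}(\lnot\phi)=\mathrm{exe}(\phi)$, $\mathrm{exe}(\phi\land\psi)=\mathrm{exe}(\phi)\cup\mathrm{exe}(\psi)$, $\mathrm{exe}([\pi]\phi)=\mathrm{exe}(\pi)\cup\mathrm{exe}(\phi)$, $\mathrm{exe}(\alpha)=\{\alpha\}$, $\mathrm{exe}(\pi_1;\pi_2)=\mathrm{exe}(\pi_1)\mathrm{exe}(\pi_2)$, $\mathrm{exe}(\pi_1\cup\pi_2)=\mathrm{exe}(\pi_1)\cup\mathrm{exe}(\pi_2)$, $\mathrm{exe}(\pi^*)=\bigcup_n \mathrm{exe}(\pi)^n$, $\mathrm{exe}(\phi?)=\mathrm{exe}(\phi)$.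 A *label* $\sigma$ is a finite, possibly empty, sequence of assignments; a *labelled formula* is a pair $\langle\sigma,\phi\rangle$; a *branch* is a set of labelled formulas, a *tableau* a set of branches. A rule is applied to a branch $b$ using a *witness* in $b$ and generates one or two sets by which $b$ may be extended ("$\mid$" separates alternatives): - R$\lnot$: $\langle\sigma,\lnot\lnot\phi\rangle$ gives $\langle\sigma,\phi\rangle$. R$\land$: $\langle\sigma,\phi\land\psi\rangle$ gives $\langle\sigma,\phi\rangle,\langle\sigma,\psi\rangle$. R$\lor$: $\langle\sigma,\lnot(\phi\land\psi)\rangle$ gives $\langle\sigma,\lnot\phi\rangle\mid\langle\sigma,\lnot\psi\rangle$. - R$[\alpha]$: $\langle\sigma,[\alpha]\phi\rangle$ gives $\langle\sigma\alpha,\phi\rangle$ with all $\langle\sigma\alpha,p\rangle$ for $\alpha(p)=\top$ and all $\langle\sigma\alpha,\lnot p\rangle$ for $\alpha(p)=\bot$. R$\langle\alpha\rangle$: the same from $\langle\sigma,\lnot[\alpha]\phi\rangle$, with $\lnot\phi$ in place of $\phi$. - R$[?]$: $\langle\sigma,[\psi?]\phi\rangle$ gives $\langle\sigma,\lnot\psi\rangle\mid\langle\sigma,\phi\rangle$.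 R$\langle?\rangle$: $\langle\sigma,\lnot[\psi?]\phi\rangle$ gives $\langle\sigma,\psi\rangle,\langle\sigma,\lnot\phi\rangle$. - R$[;]$: $\langle\sigma,[\pi_1;\pi_2]\phi\rangle$ gives $\langle\sigma,[\pi_1][\pi_2]\phi\rangle$. R$\langle;\rangle$: the same with both formulas negated. - R$[\cup]$: $\langle\sigma,[\pi_1\cup\pi_2]\phi\rangle$ gives $\langle\sigma,[\pi_1]\phi\rangle,\langle\sigma,[\pi_2]\phi\rangle$. R$\langle\cup\rangle$: $\langle\sigma,\lnot[\pi_1\cup\pi_2]\phi\rangle$ gives $\langle\sigma,\lnot[\pi_1]\phi\rangle\mid\langle\sigma,\lnot[\pi_2]\phi\rangle$. - R$[*]$: $\langle\sigma,[\pi^*]\phi\rangle$ gives $\langle\sigma,\phi\rangle,\langle\sigma,[\pi][\pi^*]\phi\rangle$. R$\langle*\rangle$: $\langle\sigma,\lnot[\pi^*]\phi\rangle$ gives $\langle\sigma,\lnot\phi\rangle\mid\langle\sigma,\phi\rangle,\langle\sigma,\lnot[\pi][\pi^*]\phi\rangle$. - RP1, RP2: if $\langle\sigma,\ell\rangle$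 and some $\langle\sigma\alpha,\psi\rangle$ are in $b$, where $\ell=p$ (RP1) or $\ell=\lnot p$ (RP2) and $p\notin\mathrm{dom}(\alpha)$, the witness $\langle\sigma,\ell\rangle$ gives $\langle\sigma\alpha,\ell\rangle$. In each branch a labelled formula may be marked *non-applicable*; marked formulas no longer count as (applicable) witnesses, and marks are inherited by extended branches. A label $\sigma$ of $b$ is *saturated* if for each rule and each witness $\langle\sigma,\phi\rangle$ to it in $b$, $b$ contains one of the generated sets; $b$ is saturated if all its labels are. An eventuality $\langle\sigma,\lnot[\pi^*]\phi\rangle$ is *fulfilled* in $b$ if $\langle\sigma\sigma',\lnot\phi\rangle\in b$ for some $\sigma'\in\mathrm{exe}(\pi^*)$. A label $\sigma$ is *closed* in $b$ if $\langle\sigma,\phi\rangle,\langle\sigma,\lnot\phi\rangle\in b$ for some $\phi$, or $b$ is saturated and contains an unfulfilled eventuality labelled $\sigma$, or $b$ was explicitly closed at $\sigma$ (step 3). A branch is closed if one of its labels is, and a tableau is closed if all its branches are; *open* means not closed. Labels $\sigma,\sigma'$ of a tableau $T$ are *equal* if there are $b_1,b_2\in T$, in which $\sigma$, resp. $\sigma'$,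 occurs, such that $\{\phi:\langle\sigma,\phi\rangle\in b_1\}=\{\phi:\langle\sigma',\phi\rangle\in b_2\}$. **Algorithm.** Input: $V\subseteq\mathbb P$ and a formula $\phi_0$. Start with $T=\{b_0\}$, where $b_0=\{\langle(),p\rangle:p\in\mathbb P_{\phi_0}\cap V\}\cup\{\langle(),\lnot p\rangle:p\in\mathbb P_{\phi_0}\setminus V\}\cup\{\langle(),\phi_0\rangle\}$, with nothing marked. While $T$ has an open unsaturated branch, pick one, $b$; while $b$ is open and unsaturated, pick an open unsaturated label $\sigma$ of $b$ and execute the first of the following that is possible (if none is, change nothing): 1. Take an applicable witness $\lambda\in b$ with label $\sigma$ to one of R$\lnot$, R$\land$, R$\langle?\rangle$, R$[;]$, R$\langle;\rangle$, R$[\cup]$, R$[*]$; mark $\lambda$ and replace $b$ in $T$ by $b\cup b_1$, where $b_1$ is the generated set. 2. Take an applicable witness $\lambda\in b$ with label $\sigma$ to one of R$\lor$, R$[?]$, R$\langle\cup\rangle$, R$\langle*\rangle$; mark $\lambda$ and replace $b$ in $T$ by $b\cup b_1$ and $b\cup b_2$, where $b_1,b_2$ are the generated sets. 3. If $T$ has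 a label $\sigma'\neq\sigma$ (as sequences) equal to $\sigma$, take one, mark all formulas of $b$ labelled by $\sigma$, and if $\sigma'$ is closed (in a branch of $T$ where it has the same formulas as $\sigma$ has in some branch of $T$), close $b$ (at $\sigma$). 4. Take an $\alpha$ and an applicable witness of the form $\langle\sigma,[\alpha]\psi\rangle$ or $\langle\sigma,\lnot[\alpha]\psi\rangle$ in $b$; mark it and let $b_1$ be the set generated by R$[\alpha]$ or R$\langle\alpha\rangle$. While $b$ contains another applicable witness of this form with the same $\sigma$ and $\alpha$, mark it and add the generated set to $b_1$. Then, while $b\cup b_1$ contains an applicable witness to RP1 or RP2, mark it and add the generated set to $b_1$. Finally replace $b$ in $T$ by $b\cup b_1$. After each replacement, the inner loop continues with (one of) the new branch(es). When the outer loop ends, return **true** if $T$ is open and **false** otherwise. **Theorem (Termination).** The algorithm halts for every input $(V,\phi_0)$: however its choices are made, it has no infinite execution (including its inner loops), and every execution that cannot be continued has ended by returning an answer. -/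

import Mathlib

namespace DLPA

universe u

/-! ### Syntax -/

/-- A propositional assignment: a non-empty finite partial function from `P` to `{⊥, ⊤}`. -/
structure Assignment (P : Type u) where
  val : P → Option Bool
  finite_dom : {p | val p ≠ none}.Finite
  nonempty_dom : {p | val p ≠ none}.Nonempty

/-- The domain of an assignment. -/
def Assignment.dom {P : Type u} (α : Assignment P) : Set P := {p | α.val p ≠ none}

mutual
/-- Formulas. -/
inductive Form (P : Type u) where
  | var (p : P)
  | neg (φ : Form P)
  | and (φ ψ : Form P)
  | box (π : Prog P) (φ : Form P)
/-- Programs. -/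
inductive Prog (P : Type u) where
  | assign (α : Assignment P)
  | seq (π₁ π₂ : Prog P)
  | choice (π₁ π₂ : Prog P)
  | star (π : Prog P)
  | test (φ : Form P)
end

mutual
/-- The propositional variables occurring in a formula. -/
def Form.vars {P : Type*} : Form P → Set P
  | .var p => {p}
  | .neg φ => φ.vars
  | .and φ ψ => φ.vars ∪ ψ.vars
  | .box π φ => π.vars ∪ φ.vars
/-- The propositional variables occurring in a program. -/
def Prog.vars {P : Type*} : Prog P → Set P
  | .assign α => α.dom
  | .seq π₁ π₂ => π₁.vars ∪ π₂.vars
  | .choice π₁ π₂ => π₁.vars ∪ π₂.vars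
  | .star π => π.vars
  | .test φ => φ.vars
end

mutual
/-- Execution traces of (the programs in) a formula; `1` is the language whose only word is the
empty sequence and `+` is union. -/
def Form.exe {P : Type*} : Form P → Language (Assignment P)
  | .var _ => 1
  | .neg φ => φ.exe
  | .and φ ψ => φ.exe + ψ.exe
  | .box π φ => π.exe + φ.exe
/-- Execution traces of a program; `*` is elementwise concatenation and `KStar.kstar` collects
the concatenations of finitely many (possibly zero) words. -/
def Prog.exe {P : Type*} : Prog P → Language (Assignment P)
  | .assign α => {[α]}
  | .seq π₁ π₂ => π₁.exe * π₂.exe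
  | .choice π₁ π₂ => π₁.exe + π₂.exe
  | .star π => KStar.kstar π.exe
  | .test φ => φ.exe
end

/-! ### Labelled formulas and tableau rules -/

/-- A label: a finite, possibly empty, sequence of assignments. -/
abbrev Label (P : Type*) := List (Assignment P)

/-- A labelled formula. -/
abbrev LForm (P : Type*) := Label P × Form P

/-- The names of the tableau rules. -/
inductive Rule where
  | neg | and | or
  | boxAssign | diaAssign
  | boxTest | diaTest
  | boxSeq | diaSeq
  | boxChoice | diaChoice
  | boxStar | diaStar
  | prop1 | prop2

/-- The literals `⟨σα, p⟩` with `α(p) = ⊤` and `⟨σα, ¬p⟩` with `α(p) = ⊥`. -/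
def effect {P : Type*} (σ : Label P) (α : Assignment P) : Set (LForm P) :=
  {l | ∃ p, α.val p = some true ∧ l = (σ ++ [α], .var p)} ∪
  {l | ∃ p, α.val p = some false ∧ l = (σ ++ [α], .neg (.var p))}

/-- `Generates ρ b l bs`: the labelled formula `l` belongs to the set `b` and allows the
application of the rule `ρ` to `b` (it is a witness to `ρ` in `b`), and `bs = [b₁, …, bₖ]` is the
list of the sets by which that application extends `b`. -/
inductive Generates {P : Type*} :
    Rule → Set (LForm P) → LForm P → List (Set (LForm P)) → Prop
  | neg {b σ φ} : (σ, .neg (.neg φ)) ∈ b →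
      Generates .neg b (σ, .neg (.neg φ)) [{(σ, φ)}]
  | and {b σ φ ψ} : (σ, .and φ ψ) ∈ b →
      Generates .and b (σ, .and φ ψ) [{(σ, φ), (σ, ψ)}]
  | or {b σ φ ψ} : (σ, .neg (.and φ ψ)) ∈ b →
      Generates .or b (σ, .neg (.and φ ψ)) [{(σ, .neg φ)}, {(σ, .neg ψ)}]
  | boxAssign {b σ α φ} : (σ, .box (.assign α) φ) ∈ b →
      Generates .boxAssign b (σ, .box (.assign α) φ) [{(σ ++ [α], φ)} ∪ effect σ α]
  | diaAssign {b σ α φ} : (σ, .neg (.box (.assign α) φ)) ∈ b →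
      Generates .diaAssign b (σ, .neg (.box (.assign α) φ))
        [{(σ ++ [α], .neg φ)} ∪ effect σ α]
  | boxTest {b σ ψ φ} : (σ, .box (.test ψ) φ) ∈ b →
      Generates .boxTest b (σ, .box (.test ψ) φ) [{(σ, .neg ψ)}, {(σ, φ)}]
  | diaTest {b σ ψ φ} : (σ, .neg (.box (.test ψ) φ)) ∈ b →
      Generates .diaTest b (σ, .neg (.box (.test ψ) φ)) [{(σ, ψ), (σ, .neg φ)}]
  | boxSeq {b σ π₁ π₂ φ} : (σ, .box (.seq π₁ π₂) φ) ∈ b →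
      Generates .boxSeq b (σ, .box (.seq π₁ π₂) φ) [{(σ, .box π₁ (.box π₂ φ))}]
  | diaSeq {b σ π₁ π₂ φ} : (σ, .neg (.box (.seq π₁ π₂) φ)) ∈ b →
      Generates .diaSeq b (σ, .neg (.box (.seq π₁ π₂) φ))
        [{(σ, .neg (.box π₁ (.box π₂ φ)))}]
  | boxChoice {b σ π₁ π₂ φ} : (σ, .box (.choice π₁ π₂) φ) ∈ b →
      Generates .boxChoice b (σ, .box (.choice π₁ π₂) φ) [{(σ, .box π₁ φ), (σ, .box π₂ φ)}]
  | diaChoice {b σ π₁ π₂ φ} : (σ, .neg (.box (.choice π₁ π₂) φ)) ∈ b →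
      Generates .diaChoice b (σ, .neg (.box (.choice π₁ π₂) φ))
        [{(σ, .neg (.box π₁ φ))}, {(σ, .neg (.box π₂ φ))}]
  | boxStar {b σ π φ} : (σ, .box (.star π) φ) ∈ b →
      Generates .boxStar b (σ, .box (.star π) φ) [{(σ, φ), (σ, .box π (.box (.star π) φ))}]
  | diaStar {b σ π φ} : (σ, .neg (.box (.star π) φ)) ∈ b →
      Generates .diaStar b (σ, .neg (.box (.star π) φ))
        [{(σ, .neg φ)}, {(σ, φ), (σ, .neg (.box π (.box (.star π) φ)))}]
  | prop1 {b σ p α ψ} : (σ, .var p) ∈ b → (σ ++ [α], ψ) ∈ b → p ∉ α.dom →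
      Generates .prop1 b (σ, .var p) [{(σ ++ [α], .var p)}]
  | prop2 {b σ p α ψ} : (σ, .neg (.var p)) ∈ b → (σ ++ [α], ψ) ∈ b → p ∉ α.dom →
      Generates .prop2 b (σ, .neg (.var p)) [{(σ ++ [α], .neg (.var p))}]

/-- The rules of the first `if` of the algorithm: one extension, with the same label. -/
def singleRules : Set Rule :=
  {.neg, .and, .diaTest, .boxSeq, .diaSeq, .boxChoice, .boxStar}

/-- The rules of the first `else if`: two alternative extensions, with the same label. -/
def splitRules : Set Rule := {.or, .boxTest, .diaChoice, .diaStar}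

/-- The successor-creating rules. -/
def assignRules : Set Rule := {.boxAssign, .diaAssign}

/-- The propagation rules. -/
def propRules : Set Rule := {.prop1, .prop2}

/-- `φ` has the form `[α]ψ` or `¬[α]ψ`. -/
def Form.StartsWith {P : Type*} (α : Assignment P) (φ : Form P) : Prop :=
  ∃ ψ, φ = .box (.assign α) ψ ∨ φ = .neg (.box (.assign α) ψ)

/-! ### Branches and tableaux -/

/-- A branch as the algorithm stores it: its labelled formulas, those that have been marked
'non-applicable', and the labels at which the branch was closed by the instruction
`close branch b`. -/
@[ext] structure Branch (P : Type*) where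
  forms : Set (LForm P)
  marked : Set (LForm P)
  closedAt : Set (Label P)

namespace Branch
variable {P : Type*}

/-- `σ` is a label of `b`. -/
def HasLabel (b : Branch P) (σ : Label P) : Prop := ∃ φ, (σ, φ) ∈ b.forms

/-- The formulas labelled by `σ` in `b`. -/
def formsAt (b : Branch P) (σ : Label P) : Set (Form P) := {φ | (σ, φ) ∈ b.forms}

/-- Mark the labelled formulas in `S` as 'non-applicable'. -/
def mark (b : Branch P) (S : Set (LForm P)) : Branch P := {b with marked := b.marked ∪ S}

/-- Add the labelled formulas in `S`. -/
def extend (b : Branch P) (S : Set (LForm P)) : Branch P := {b with forms := b.forms ∪ S}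

/-- Close the branch, because of its label `σ`. -/
def closeAt (b : Branch P) (σ : Label P) : Branch P := {b with closedAt := b.closedAt ∪ {σ}}

/-- `b` contains an applicable witness labelled by `σ` to a rule in `R`. -/
def HasApplicable (b : Branch P) (R : Set Rule) (σ : Label P) : Prop :=
  ∃ ρ ∈ R, ∃ φ bs, Generates ρ b.forms (σ, φ) bs ∧ (σ, φ) ∉ b.marked

/-- The label `σ` is saturated in `b`: for every rule and every witness `⟨σ, φ⟩` to it, `b`
contains one of the generated extensions. Formulas marked 'non-applicable' are not witnesses. -/
def LabelSaturated (b : Branch P) (σ : Label P) : Prop :=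
  ∀ ρ φ bs, Generates ρ b.forms (σ, φ) bs → (σ, φ) ∉ b.marked → ∃ c ∈ bs, c ⊆ b.forms

/-- All labels of `b` are saturated. -/
def Saturated (b : Branch P) : Prop := ∀ σ, b.HasLabel σ → b.LabelSaturated σ

/-- The eventuality `⟨σ, ¬[π*]φ⟩` is fulfilled in `b`. -/
def Fulfilled (b : Branch P) (σ : Label P) (π : Prog P) (φ : Form P) : Prop :=
  ∃ τ ∈ (Prog.star π).exe, (σ ++ τ, .neg φ) ∈ b.forms

/-- The label `σ` is closed in `b`. -/
def LabelClosed (b : Branch P) (σ : Label P) : Prop :=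
  σ ∈ b.closedAt ∨
  (∃ φ, (σ, φ) ∈ b.forms ∧ (σ, .neg φ) ∈ b.forms) ∨
  (b.Saturated ∧ ∃ π φ, (σ, .neg (.box (.star π) φ)) ∈ b.forms ∧ ¬ b.Fulfilled σ π φ)

/-- A branch is closed if the algorithm closed it explicitly, or it is blatantly inconsistent, or
it is saturated and contains an unfulfilled eventuality; that is, if one of its labels is closed.
It is open otherwise. -/
def Closed (b : Branch P) : Prop := ∃ σ, b.LabelClosed σ

end Branch

/-- The initial branch for `(V, φ₀)`, with no marks. -/
def initialBranch {P : Type*} (V : Set P) (φ₀ : Form P) : Branch P where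
  forms := {l | ∃ p ∈ φ₀.vars ∩ V, l = ([], .var p)} ∪
    {l | ∃ p ∈ φ₀.vars \ V, l = ([], .neg (.var p))} ∪ {([], φ₀)}
  marked := ∅
  closedAt := ∅

/-- A tableau: a set of branches. -/
abbrev Tableau (P : Type*) := Set (Branch P)

/-- `(T \ {b}) ∪ B`. -/
def Tableau.replace {P : Type*} (T : Tableau P) (b : Branch P) (B : Set (Branch P)) :
    Tableau P := (T \ {b}) ∪ B

/-- The labels `σ` and `σ'` of `T` carry the same set of formulas, `σ` in some branch of `T` and
`σ'` in the branch `c` of `T`. -/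
def Tableau.EqualVia {P : Type*} (T : Tableau P) (σ σ' : Label P) (c : Branch P) : Prop :=
  c ∈ T ∧ c.HasLabel σ' ∧ ∃ b ∈ T, b.HasLabel σ ∧ b.formsAt σ = c.formsAt σ'

/-- There is another label of `T` that is equal to `σ`. -/
def Tableau.HasEqual {P : Type*} (T : Tableau P) (σ : Label P) : Prop :=
  ∃ σ', σ' ≠ σ ∧ ∃ c, T.EqualVia σ σ' c

/-! ### The algorithm, as a small-step transition system -/

/-- A control point of the algorithm with the values of its variables. -/
inductive State (P : Type*) where
  /-- At the test of the outer loop. -/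
  | outer (T : Tableau P)
  /-- At the test of the loop on the branch `b`. -/
  | inner (T : Tableau P) (b : Branch P)
  /-- The label `σ` of `b` was picked; about to run the `if` cascade. -/
  | select (T : Tableau P) (b : Branch P) (σ : Label P)
  /-- At the test of the loop collecting the formulas `[α]ψ`, `¬[α]ψ` labelled by `σ`. -/
  | collect (T : Tableau P) (b : Branch P) (σ : Label P) (α : Assignment P) (b₁ : Set (LForm P))
  /-- At the test of the loop applying the propagation rules. -/
  | propagate (T : Tableau P) (b : Branch P) (b₁ : Set (LForm P))
  /-- The algorithm has returned. -/
  | returned (answer : Bool)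

open Branch State in
/-- One step of the algorithm. Every `pick`, and every choice of a witness, may be resolved
arbitrarily. Marking is done in place, on the stored branch. After an update of the tableau the
loop variable `b` is (one of) the branch(es) by which `b` was replaced. -/
inductive Step {P : Type*} : State P → State P → Prop
  /-- Outer loop: pick an open and unsaturated branch. -/
  | pickBranch {T b} : b ∈ T → ¬ b.Closed → ¬ b.Saturated →
      Step (outer T) (inner T b)
  /-- No such branch: return whether the tableau is open. -/
  | returnTrue {T} : (∀ b ∈ T, b.Closed ∨ b.Saturated) → (∃ b ∈ T, ¬ b.Closed) →
      Step (outer T) (returned true)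
  | returnFalse {T} : (∀ b ∈ T, b.Closed ∨ b.Saturated) → (∀ b ∈ T, b.Closed) →
      Step (outer T) (returned false)
  /-- Inner loop: `b` is open and unsaturated; pick an open unsaturated label of `b`. -/
  | pickLabel {T b σ} : ¬ b.Closed → ¬ b.Saturated →
      b.HasLabel σ → ¬ b.LabelClosed σ → ¬ b.LabelSaturated σ →
      Step (inner T b) (select T b σ)
  | leaveInner {T b} : b.Closed ∨ b.Saturated →
      Step (inner T b) (outer T)
  /-- `if`: a local rule with one extension. -/
  | single {T b σ ρ φ b₁ b'} : ρ ∈ singleRules →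
      Generates ρ b.forms (σ, φ) [b₁] → (σ, φ) ∉ b.marked →
      b' = (b.mark {(σ, φ)}).extend b₁ →
      Step (select T b σ) (inner (T.replace b {b'}) b')
  /-- `else if`: a local rule with two alternative extensions. -/
  | split {T b σ ρ φ b₁ b₂ c₁ c₂ b'} : ¬ b.HasApplicable singleRules σ → ρ ∈ splitRules →
      Generates ρ b.forms (σ, φ) [b₁, b₂] → (σ, φ) ∉ b.marked →
      c₁ = (b.mark {(σ, φ)}).extend b₁ → c₂ = (b.mark {(σ, φ)}).extend b₂ →
      b' = c₁ ∨ b' = c₂ →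
      Step (select T b σ) (inner (T.replace b {c₁, c₂}) b')
  /-- `else if`: another label `σ'` of the tableau is equal to `σ`; mark all formulas of `b`
  labelled by `σ`, and if `σ'` is closed then close `b`. -/
  | equalClosed {T b σ σ' b' T'} : ¬ b.HasApplicable singleRules σ →
      ¬ b.HasApplicable splitRules σ →
      σ' ≠ σ → (∃ c, T.EqualVia σ σ' c) →
      b' = b.mark {l | l ∈ b.forms ∧ l.1 = σ} → T' = T.replace b {b'} →
      (∃ c, T'.EqualVia σ σ' c ∧ c.LabelClosed σ') →
      Step (select T b σ) (inner (T'.replace b' {b'.closeAt σ}) (b'.closeAt σ))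
  | equalOpen {T b σ σ' b' T'} : ¬ b.HasApplicable singleRules σ →
      ¬ b.HasApplicable splitRules σ →
      σ' ≠ σ → (∃ c, T.EqualVia σ σ' c) →
      b' = b.mark {l | l ∈ b.forms ∧ l.1 = σ} → T' = T.replace b {b'} →
      (¬ ∃ c, T'.EqualVia σ σ' c ∧ c.LabelClosed σ') →
      Step (select T b σ) (inner T' b')
  /-- `else if`: start creating the successor of `σ` by an atomic program `α`. -/
  | create {T b σ ρ φ α b₁ b'} : ¬ b.HasApplicable singleRules σ →
      ¬ b.HasApplicable splitRules σ → ¬ T.HasEqual σ →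
      ρ ∈ assignRules → φ.StartsWith α →
      Generates ρ b.forms (σ, φ) [b₁] → (σ, φ) ∉ b.marked →
      b' = b.mark {(σ, φ)} →
      Step (select T b σ) (collect (T.replace b {b'}) b' σ α b₁)
  /-- No case of the `if` cascade applies: back to the loop test, with nothing changed. -/
  | noCase {T b σ} : ¬ b.HasApplicable singleRules σ →
      ¬ b.HasApplicable splitRules σ → ¬ T.HasEqual σ →
      ¬ b.HasApplicable assignRules σ →
      Step (select T b σ) (inner T b)
  /-- Treat one more formula `[α]ψ` or `¬[α]ψ` labelled by `σ`. -/
  | collectStep {T b σ α b₁ ρ φ c b'} : ρ ∈ assignRules → φ.StartsWith α →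
      Generates ρ b.forms (σ, φ) [c] → (σ, φ) ∉ b.marked →
      b' = b.mark {(σ, φ)} →
      Step (collect T b σ α b₁) (collect (T.replace b {b'}) b' σ α (b₁ ∪ c))
  | collectEnd {T b σ α b₁} :
      (¬ ∃ ρ ∈ assignRules, ∃ φ c, φ.StartsWith α ∧ Generates ρ b.forms (σ, φ) [c] ∧
        (σ, φ) ∉ b.marked) →
      Step (collect T b σ α b₁) (propagate T b b₁)
  /-- Apply a propagation rule. -/
  | propagateStep {T b b₁ ρ l c b'} : ρ ∈ propRules →
      Generates ρ (b.forms ∪ b₁) l [c] → l ∉ b.marked →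
      b' = b.mark {l} →
      Step (propagate T b b₁) (propagate (T.replace b {b'}) b' (b₁ ∪ c))
  /-- Install the extended branch. -/
  | propagateEnd {T b b₁ b'} :
      (¬ ∃ ρ ∈ propRules, ∃ l c, Generates ρ (b.forms ∪ b₁) l [c] ∧ l ∉ b.marked) →
      b' = b.extend b₁ →
      Step (propagate T b b₁) (inner (T.replace b {b'}) b')

/-- The start of the algorithm on input `(V, φ₀)`, with the initial tableau. -/
def start {P : Type*} (V : Set P) (φ₀ : Form P) : State P := .outer {initialBranch V φ₀}

end DLPA

/-!
All formulas in a tableau for `φ₀` lie in a finite set, the Fischer–Ladner closure of `φ₀` together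
with the negations of its members. The labels of a branch, however, could grow without bound, and
an iteration of the inner loop could fail to change anything. Both are excluded by one observation:
a label that has a successor never gains another formula. The successor `σα` is created only when no
local rule is applicable at `σ` any more, and at that moment all formulas `[α]ψ` and `¬[α]ψ` and all
literals that can be passed on from `σ` to `σα` are used up and marked. Hence formulas reach `σ`
neither from itself nor, by the same argument for its parent, from above. This is the invariant
`Branch.Coherent`, which `Branch.Coherent.extend` shows to persist.

Two consequences follow. The loop check before the creation of a successor makes the formula sets
of the labels with successors pairwise different; since these sets no longer change, they stay
different, and so a label is at most as long as there are subsets of the closure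
(`Branch.Coherent.length_le`). All labelled formulas thus come from a finite set. Moreover a
propagation rule is never applicable at the start of an iteration, so an unsaturated label always
admits a case of the algorithm that marks a formula (`Branch.Coherent.exists_applicable`).

A step therefore marks a formula of a finite set, while possibly splitting one branch into two, or
it moves on towards a step that does. The sum over the branches of `3 ^ n`, where `n` is the number
of unmarked formulas, combined with the position in the program, decreases in every step
(`Step.invariant_and_measure_lt`). That the algorithm gets stuck nowhere is a case distinction
along its program (`exists_step`).
-/

namespace DLPA

section Termination

variable {P : Type*}

/-! ### The closure of the input formula -/

mutual
/-- The Fischer–Ladner closure of a formula, without negations of its members. -/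
def Form.closure : Form P → Set (Form P)
  | .var p => {.var p}
  | .neg φ => insert (.neg φ) φ.closure
  | .and φ ψ => insert (.and φ ψ) (φ.closure ∪ ψ.closure)
  | .box π φ => π.closure φ ∪ φ.closure
/-- The members of the closure of `[π]φ` that come from `π`. Those of `φ` are left out, so that the
recursion can pass to `[π₁][π₂]φ` and `[π][π*]φ` and stay structural in the program. -/
def Prog.closure : Prog P → Form P → Set (Form P)
  | .assign α, φ => insert (.box (.assign α) φ) (Form.var '' α.dom)
  | .seq π₁ π₂, φ => insert (.box (.seq π₁ π₂) φ) (π₁.closure (.box π₂ φ) ∪ π₂.closure φ)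
  | .choice π₁ π₂, φ => insert (.box (.choice π₁ π₂) φ) (π₁.closure φ ∪ π₂.closure φ)
  | .star π, φ => insert (.box (.star π) φ) (π.closure (.box (.star π) φ))
  | .test ψ, φ => insert (.box (.test ψ) φ) ψ.closure
end

/-- `Component φ ψ`: up to negation, `ψ` may be generated from `φ` by one of the rules. -/
inductive Form.Component : Form P → Form P → Prop
  | neg {φ} : Component (.neg φ) φ
  | andLeft {φ ψ} : Component (.and φ ψ) φ
  | andRight {φ ψ} : Component (.and φ ψ) ψ
  | assignVar {α φ p} : p ∈ α.dom → Component (.box (.assign α) φ) (.var p)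
  | assign {α φ} : Component (.box (.assign α) φ) φ
  | seq {π₁ π₂ φ} : Component (.box (.seq π₁ π₂) φ) (.box π₁ (.box π₂ φ))
  | choiceLeft {π₁ π₂ φ} : Component (.box (.choice π₁ π₂) φ) (.box π₁ φ)
  | choiceRight {π₁ π₂ φ} : Component (.box (.choice π₁ π₂) φ) (.box π₂ φ)
  | starBody {π φ} : Component (.box (.star π) φ) φ
  | starStep {π φ} : Component (.box (.star π) φ) (.box π (.box (.star π) φ))
  | test {ψ φ} : Component (.box (.test ψ) φ) ψ
  | testBody {ψ φ} : Component (.box (.test ψ) φ) φ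

theorem Prog.box_mem_closure (π : Prog P) (φ : Form P) : Form.box π φ ∈ π.closure φ := by
  cases π <;> simp [Prog.closure]

theorem Form.self_mem_closure (φ : Form P) : φ ∈ φ.closure := by
  cases φ <;> simp [Form.closure, Prog.box_mem_closure]

mutual
theorem Form.closure_finite : ∀ φ : Form P, φ.closure.Finite
  | .var _ => by simp [Form.closure]
  | .neg φ => by simpa [Form.closure] using φ.closure_finite
  | .and φ ψ => by simpa [Form.closure] using ⟨φ.closure_finite, ψ.closure_finite⟩
  | .box π φ => by simpa [Form.closure] using ⟨π.closure_finite φ, φ.closure_finite⟩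
theorem Prog.closure_finite : ∀ (π : Prog P) (φ : Form P), (π.closure φ).Finite
  | .assign α, φ => by
    have h : α.dom.Finite := α.finite_dom
    simpa only [Prog.closure, Set.finite_insert] using h.image _
  | .seq π₁ π₂, φ => by
    simpa [Prog.closure] using ⟨π₁.closure_finite (.box π₂ φ), π₂.closure_finite φ⟩
  | .choice π₁ π₂, φ => by
    simpa [Prog.closure] using ⟨π₁.closure_finite φ, π₂.closure_finite φ⟩
  | .star π, φ => by simpa [Prog.closure] using π.closure_finite (.box (.star π) φ)
  | .test ψ, φ => by simpa [Prog.closure] using ψ.closure_finite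
end

mutual
theorem Form.vars_finite : ∀ φ : Form P, φ.vars.Finite
  | .var _ => by simp [Form.vars]
  | .neg φ => by simpa [Form.vars] using φ.vars_finite
  | .and φ ψ => by simpa [Form.vars] using ⟨φ.vars_finite, ψ.vars_finite⟩
  | .box π φ => by simpa [Form.vars] using ⟨π.vars_finite, φ.vars_finite⟩
theorem Prog.vars_finite : ∀ π : Prog P, π.vars.Finite
  | .assign α => α.finite_dom
  | .seq π₁ π₂ => by simpa [Prog.vars] using ⟨π₁.vars_finite, π₂.vars_finite⟩
  | .choice π₁ π₂ => by simpa [Prog.vars] using ⟨π₁.vars_finite, π₂.vars_finite⟩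
  | .star π => by simpa [Prog.vars] using π.vars_finite
  | .test ψ => by simpa [Prog.vars] using ψ.vars_finite
end

mutual
theorem Form.component_mem_closure {x y : Form P} (h : x.Component y) :
    ∀ φ : Form P, x ∈ φ.closure → y ∈ φ.closure
  | .var p, hx => by
    simp only [Form.closure, Set.mem_singleton_iff] at hx
    subst hx; cases h
  | .neg φ, hx => by
    simp only [Form.closure, Set.mem_insert_iff] at hx ⊢
    rcases hx with rfl | hx
    · cases h; exact .inr (Form.self_mem_closure _)
    · exact .inr (Form.component_mem_closure h φ hx)
  | .and φ ψ, hx => by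
    simp only [Form.closure, Set.mem_insert_iff, Set.mem_union] at hx ⊢
    rcases hx with rfl | hx | hx
    · cases h
      · exact .inr (.inl (Form.self_mem_closure _))
      · exact .inr (.inr (Form.self_mem_closure _))
    · exact .inr (.inl (Form.component_mem_closure h φ hx))
    · exact .inr (.inr (Form.component_mem_closure h ψ hx))
  | .box π φ, hx => by
    simp only [Form.closure, Set.mem_union] at hx ⊢
    rcases hx with hx | hx
    · rcases Prog.component_mem_closure h π φ hx with rfl | hy
      · exact .inr (Form.self_mem_closure _)
      · exact .inl hy
    · exact .inr (Form.component_mem_closure h φ hx)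
theorem Prog.component_mem_closure {x y : Form P} (h : x.Component y) :
    ∀ (π : Prog P) (φ : Form P), x ∈ π.closure φ → y = φ ∨ y ∈ π.closure φ
  | .assign α, φ, hx => by
    simp only [Prog.closure, Set.mem_insert_iff, Set.mem_image] at hx ⊢
    rcases hx with rfl | ⟨p, -, rfl⟩
    · cases h with
      | assignVar hp => exact .inr (.inr ⟨_, hp, rfl⟩)
      | assign => exact .inl rfl
    · cases h
  | .seq π₁ π₂, φ, hx => by
    simp only [Prog.closure, Set.mem_insert_iff, Set.mem_union] at hx ⊢
    rcases hx with rfl | hx | hx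
    · cases h; exact .inr (.inr (.inl (π₁.box_mem_closure _)))
    · rcases Prog.component_mem_closure h π₁ _ hx with rfl | hy
      · exact .inr (.inr (.inr (π₂.box_mem_closure _)))
      · exact .inr (.inr (.inl hy))
    · rcases Prog.component_mem_closure h π₂ _ hx with hy | hy
      · exact .inl hy
      · exact .inr (.inr (.inr hy))
  | .choice π₁ π₂, φ, hx => by
    simp only [Prog.closure, Set.mem_insert_iff, Set.mem_union] at hx ⊢
    rcases hx with rfl | hx | hx
    · cases h
      · exact .inr (.inr (.inl (π₁.box_mem_closure _)))
      · exact .inr (.inr (.inr (π₂.box_mem_closure _)))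
    · rcases Prog.component_mem_closure h π₁ _ hx with hy | hy
      · exact .inl hy
      · exact .inr (.inr (.inl hy))
    · rcases Prog.component_mem_closure h π₂ _ hx with hy | hy
      · exact .inl hy
      · exact .inr (.inr (.inr hy))
  | .star π, φ, hx => by
    simp only [Prog.closure, Set.mem_insert_iff] at hx ⊢
    rcases hx with rfl | hx
    · cases h
      · exact .inl rfl
      · exact .inr (.inr (π.box_mem_closure _))
    · exact .inr (Prog.component_mem_closure h π _ hx)
  | .test ψ, φ, hx => by
    simp only [Prog.closure, Set.mem_insert_iff] at hx ⊢
    rcases hx with rfl | hx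
    · cases h
      · exact .inr (.inr (Form.self_mem_closure _))
      · exact .inl rfl
    · exact .inr (.inr (Form.component_mem_closure h ψ hx))
end

/-- A set of formulas that rule applications do not leave. -/
def RuleClosed (C : Set (Form P)) : Prop :=
  ∀ ρ b l bs, Generates ρ b l bs → l.2 ∈ C → ∀ c ∈ bs, ∀ m ∈ c, m.2 ∈ C

/-- All formulas that can occur in a tableau for `φ₀`. The literals over `φ₀.vars` are those of the
initial branch. -/
def Form.tableauClosure (φ₀ : Form P) : Set (Form P) :=
  (φ₀.closure ∪ Form.var '' φ₀.vars) ∪ Form.neg '' (φ₀.closure ∪ Form.var '' φ₀.vars)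

theorem Form.tableauClosure_finite (φ₀ : Form P) : φ₀.tableauClosure.Finite := by
  have h := φ₀.closure_finite.union (φ₀.vars_finite.image Form.var)
  exact h.union (h.image _)

/-- Adding one negation to each member of a set closed under components makes it closed under the
rules. -/
theorem ruleClosed_union_neg {D : Set (Form P)} (hD : ∀ x ∈ D, ∀ y, x.Component y → y ∈ D) :
    RuleClosed (D ∪ Form.neg '' D) := by
  have hneg : ∀ x, Form.neg x ∈ D ∪ Form.neg '' D → x ∈ D := by
    rintro x (h | ⟨y, hy, h⟩)
    · exact hD _ h _ .neg
    · cases h; exact hy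
  have hbox : ∀ π φ, Form.box π φ ∈ D ∪ Form.neg '' D → Form.box π φ ∈ D := by
    rintro π φ (h | ⟨y, hy, h⟩)
    · exact h
    · cases h
  have hand : ∀ φ ψ, Form.and φ ψ ∈ D ∪ Form.neg '' D → Form.and φ ψ ∈ D := by
    rintro φ ψ (h | ⟨y, hy, h⟩)
    · exact h
    · cases h
  have hnot : ∀ x ∈ D, Form.neg x ∈ D ∪ Form.neg '' D := fun x h => .inr ⟨x, h, rfl⟩
  have heff : ∀ σ α φ, Form.box (.assign α) φ ∈ D → ∀ m ∈ effect σ α,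
      m.2 ∈ D ∪ Form.neg '' D := by
    rintro σ α φ h m (⟨p, hp, rfl⟩ | ⟨p, hp, rfl⟩)
    · exact .inl (hD _ h _ (.assignVar (by simp [Assignment.dom, hp])))
    · exact hnot _ (hD _ h _ (.assignVar (by simp [Assignment.dom, hp])))
  intro ρ b l bs hg hl c hc m hm
  cases hg <;> simp only [List.mem_cons, List.not_mem_nil, or_false] at hc
  case neg => subst hc; cases hm; exact .inl (hD _ (hneg _ hl) _ .neg)
  case and =>
    subst hc
    rcases hm with rfl | rfl
    · exact .inl (hD _ (hand _ _ hl) _ .andLeft)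
    · exact .inl (hD _ (hand _ _ hl) _ .andRight)
  case or =>
    rcases hc with rfl | rfl <;> cases hm
    · exact hnot _ (hD _ (hneg _ hl) _ .andLeft)
    · exact hnot _ (hD _ (hneg _ hl) _ .andRight)
  case boxAssign =>
    subst hc
    rcases hm with rfl | hm
    · exact .inl (hD _ (hbox _ _ hl) _ .assign)
    · exact heff _ _ _ (hbox _ _ hl) _ hm
  case diaAssign =>
    subst hc
    rcases hm with rfl | hm
    · exact hnot _ (hD _ (hneg _ hl) _ .assign)
    · exact heff _ _ _ (hneg _ hl) _ hm
  case boxTest =>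
    rcases hc with rfl | rfl <;> cases hm
    · exact hnot _ (hD _ (hbox _ _ hl) _ .test)
    · exact .inl (hD _ (hbox _ _ hl) _ .testBody)
  case diaTest =>
    subst hc
    rcases hm with rfl | rfl
    · exact .inl (hD _ (hneg _ hl) _ .test)
    · exact hnot _ (hD _ (hneg _ hl) _ .testBody)
  case boxSeq => subst hc; cases hm; exact .inl (hD _ (hbox _ _ hl) _ .seq)
  case diaSeq => subst hc; cases hm; exact hnot _ (hD _ (hneg _ hl) _ .seq)
  case boxChoice =>
    subst hc
    rcases hm with rfl | rfl
    · exact .inl (hD _ (hbox _ _ hl) _ .choiceLeft)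
    · exact .inl (hD _ (hbox _ _ hl) _ .choiceRight)
  case diaChoice =>
    rcases hc with rfl | rfl <;> cases hm
    · exact hnot _ (hD _ (hneg _ hl) _ .choiceLeft)
    · exact hnot _ (hD _ (hneg _ hl) _ .choiceRight)
  case boxStar =>
    subst hc
    rcases hm with rfl | rfl
    · exact .inl (hD _ (hbox _ _ hl) _ .starBody)
    · exact .inl (hD _ (hbox _ _ hl) _ .starStep)
  case diaStar =>
    rcases hc with rfl | rfl
    · cases hm; exact hnot _ (hD _ (hneg _ hl) _ .starBody)
    · rcases hm with rfl | rfl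
      · exact .inl (hD _ (hneg _ hl) _ .starBody)
      · exact hnot _ (hD _ (hneg _ hl) _ .starStep)
  case prop1 => subst hc; cases hm; exact hl
  case prop2 => subst hc; cases hm; exact hl

theorem Form.ruleClosed_tableauClosure (φ₀ : Form P) : RuleClosed φ₀.tableauClosure := by
  refine ruleClosed_union_neg ?_
  rintro x (hx | ⟨p, -, rfl⟩) y h
  · exact .inl (Form.component_mem_closure h _ hx)
  · cases h

/-! ### Rule applications -/

theorem Generates.witness_mem {ρ b} {l : LForm P} {bs} (h : Generates ρ b l bs) : l ∈ b := by
  cases h <;> assumption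

theorem Generates.rule_cases {ρ b} {l : LForm P} {bs} (_ : Generates ρ b l bs) :
    ρ ∈ singleRules ∨ ρ ∈ splitRules ∨ ρ ∈ assignRules ∨ ρ ∈ propRules := by
  cases ρ <;> simp [singleRules, splitRules, assignRules, propRules]

theorem Generates.eq_singleton {ρ b} {l : LForm P} {bs} (h : Generates ρ b l bs)
    (hρ : ρ ∉ splitRules) : ∃ c, bs = [c] := by
  cases h <;> first | exact ⟨_, rfl⟩ | simp [splitRules] at hρ

theorem Generates.eq_pair {ρ b} {l : LForm P} {bs} (h : Generates ρ b l bs)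
    (hρ : ρ ∈ splitRules) : ∃ c₁ c₂, bs = [c₁, c₂] := by
  cases h <;> first | exact ⟨_, _, rfl⟩ | simp [splitRules] at hρ

/-- The local rules generate formulas with the label of the witness. -/
theorem Generates.label_eq {ρ b} {l : LForm P} {bs} (h : Generates ρ b l bs)
    (hρ : ρ ∈ singleRules ∨ ρ ∈ splitRules) : ∀ c ∈ bs, ∀ m ∈ c, m.1 = l.1 := by
  intro c hc m hm
  cases h <;> simp only [List.mem_cons, List.not_mem_nil, or_false] at hc <;>
    simp [singleRules, splitRules] at hρ <;>
    first
    | (subst hc; rcases hm with rfl | rfl <;> rfl)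
    | (rcases hc with rfl | rfl
       · cases hm; rfl
       · rcases hm with rfl | rfl <;> rfl)

theorem Generates.startsWith {ρ b} {σ : Label P} {φ bs} (h : Generates ρ b (σ, φ) bs)
    (hρ : ρ ∈ assignRules) : ∃ α, φ.StartsWith α := by
  cases h <;> simp [assignRules] at hρ
  · exact ⟨_, _, .inl rfl⟩
  · exact ⟨_, _, .inr rfl⟩

theorem Generates.label_eq_of_startsWith {ρ b} {σ : Label P} {φ bs α}
    (h : Generates ρ b (σ, φ) bs) (hρ : ρ ∈ assignRules) (hφ : φ.StartsWith α) :
    ∀ c ∈ bs, ∀ m ∈ c, m.1 = σ ++ [α] := by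
  intro c hc m hm
  obtain ⟨ψ, rfl | rfl⟩ := hφ <;> cases h <;> simp [assignRules] at hρ <;>
    simp only [List.mem_cons, List.not_mem_nil, or_false] at hc <;> subst hc <;>
    rcases hm with rfl | ⟨p, -, rfl⟩ | ⟨p, -, rfl⟩ <;> rfl

/-- A propagation rule copies its witness to a successor label, and needs nothing else of the
branch. -/
theorem Generates.of_propRules {ρ b} {l : LForm P} {bs} (h : Generates ρ b l bs)
    (hρ : ρ ∈ propRules) :
    ∃ α ψ, (l.1 ++ [α], ψ) ∈ b ∧ bs = [{(l.1 ++ [α], l.2)}] ∧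
      ∀ b' ψ', l ∈ b' → (l.1 ++ [α], ψ') ∈ b' → Generates ρ b' l bs := by
  cases h with
  | prop1 _ h h' => exact ⟨_, _, h, rfl, fun _ _ h₁ h₂ => .prop1 h₁ h₂ h'⟩
  | prop2 _ h h' => exact ⟨_, _, h, rfl, fun _ _ h₁ h₂ => .prop2 h₁ h₂ h'⟩
  | _ => simp [propRules] at hρ

/-- Whether a labelled formula is a witness depends only on its own membership and, for the
propagation rules, on which successor labels occur. -/
theorem Generates.transfer {ρ b b'} {l : LForm P} {bs} (h : Generates ρ b l bs) (hl : l ∈ b')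
    (hsucc : ρ ∈ propRules → ∀ α ψ, (l.1 ++ [α], ψ) ∈ b → ∃ ψ', (l.1 ++ [α], ψ') ∈ b') :
    Generates ρ b' l bs := by
  by_cases hρ : ρ ∈ propRules
  · obtain ⟨α, ψ, hψ, -, hb'⟩ := h.of_propRules hρ
    obtain ⟨ψ', hψ'⟩ := hsucc hρ α ψ hψ
    exact hb' b' ψ' hl hψ'
  · cases h <;> first | (constructor; exact hl; done) | simp [propRules] at hρ

theorem not_assignRules_of_single {ρ : Rule} (h : ρ ∈ singleRules) : ρ ∉ assignRules := by
  cases ρ <;> simp_all [singleRules, assignRules]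

theorem not_assignRules_of_split {ρ : Rule} (h : ρ ∈ splitRules) : ρ ∉ assignRules := by
  cases ρ <;> simp_all [splitRules, assignRules]

theorem not_assignRules_of_prop {ρ : Rule} (h : ρ ∈ propRules) : ρ ∉ assignRules := by
  cases ρ <;> simp_all [propRules, assignRules]

theorem not_splitRules_of_single {ρ : Rule} (h : ρ ∈ singleRules) : ρ ∉ splitRules := by
  cases ρ <;> simp_all [singleRules, splitRules]

theorem not_splitRules_of_assign {ρ : Rule} (h : ρ ∈ assignRules) : ρ ∉ splitRules := by
  cases ρ <;> simp_all [assignRules, splitRules]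

theorem not_splitRules_of_prop {ρ : Rule} (h : ρ ∈ propRules) : ρ ∉ splitRules := by
  cases ρ <;> simp_all [propRules, splitRules]

theorem not_propRules_of_single {ρ : Rule} (h : ρ ∈ singleRules) : ρ ∉ propRules := by
  cases ρ <;> simp_all [singleRules, propRules]

theorem not_propRules_of_split {ρ : Rule} (h : ρ ∈ splitRules) : ρ ∉ propRules := by
  cases ρ <;> simp_all [splitRules, propRules]

/-! ### Coherent branches -/

/-- The properties that the algorithm keeps true of every branch of its tableau; `C` is the closure
of the input formula. -/
structure Branch.Coherent (C : Set (Form P)) (b : Branch P) : Prop where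
  mem_closure : ∀ l ∈ b.forms, l.2 ∈ C
  /-- The labels are closed under prefixes, and are words over the assignments that occur in `C`. -/
  parent : ∀ σ α, b.HasLabel (σ ++ [α]) → b.HasLabel σ ∧ ∃ φ ∈ C, φ.StartsWith α
  /-- Once a label has a successor by `α`, the only rules still applicable at it are those that
  create a successor by another assignment. -/
  settled : ∀ σ α ρ φ bs, b.HasLabel (σ ++ [α]) → Generates ρ b.forms (σ, φ) bs →
    (σ, φ) ∉ b.marked → ρ ∈ assignRules ∧ ¬ φ.StartsWith α
  /-- Different labels with successors carry different sets of formulas. -/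
  formsAt_inj : ∀ σ α τ β, b.HasLabel (σ ++ [α]) → b.HasLabel (τ ++ [β]) →
    b.formsAt σ = b.formsAt τ → σ = τ

theorem Branch.Coherent.of_marked_subset {C : Set (Form P)} {b b' : Branch P} (h : b.Coherent C)
    (hf : b'.forms = b.forms) (hm : b.marked ⊆ b'.marked) : b'.Coherent C := by
  obtain ⟨f, m, c⟩ := b
  obtain ⟨f', m', c'⟩ := b'
  obtain rfl : f' = f := hf
  exact ⟨h.mem_closure, h.parent,
    fun σ α ρ φ bs h₁ h₂ h₃ => h.settled σ α ρ φ bs h₁ h₂ fun h₄ => h₃ (hm h₄), h.formsAt_inj⟩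

theorem Branch.Coherent.mark {C : Set (Form P)} {b : Branch P} (h : b.Coherent C)
    (S : Set (LForm P)) : (b.mark S).Coherent C :=
  h.of_marked_subset rfl Set.subset_union_left

theorem Branch.Coherent.closeAt {C : Set (Form P)} {b : Branch P} (h : b.Coherent C)
    (σ : Label P) : (b.closeAt σ).Coherent C :=
  h.of_marked_subset rfl subset_rfl

theorem Branch.Coherent.hasLabel_of_append {C : Set (Form P)} {b : Branch P} (h : b.Coherent C)
    (σ τ : Label P) (hτ : b.HasLabel (σ ++ τ)) : b.HasLabel σ := by
  induction τ using List.reverseRecOn with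
  | nil => simpa using hτ
  | append_singleton τ α ih =>
    rw [← List.append_assoc] at hτ
    exact ih (h.parent _ _ hτ).1

/-- The proper prefixes of a label carry pairwise different subsets of `C`. -/
theorem Branch.Coherent.length_le {C : Set (Form P)} (hC : C.Finite) {b : Branch P}
    (h : b.Coherent C) {τ : Label P} (hτ : b.HasLabel τ) : τ.length ≤ (𝒫 C).ncard := by
  have hlab : ∀ i (hi : i < τ.length), b.HasLabel (τ.take i ++ [τ[i]]) := by
    intro i hi
    refine h.hasLabel_of_append _ (τ.drop (i + 1)) ?_
    simpa using hτ
  have := Set.ncard_le_ncard_of_injOn (s := (Finset.range τ.length : Set ℕ)) (t := 𝒫 C)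
    (fun i => b.formsAt (τ.take i)) (fun _ _ _ hφ => h.mem_closure _ hφ) (by
      intro i hi j hj hij
      simp only [Finset.coe_range, Set.mem_Iio] at hi hj
      have := congrArg List.length (h.formsAt_inj _ _ _ _ (hlab i hi) (hlab j hj) hij)
      simp only [List.length_take] at this
      omega) hC.finite_subsets
  simpa using this

theorem Branch.Coherent.mem_label {C : Set (Form P)} {b : Branch P}
    (h : b.Coherent C) {τ : Label P} (hτ : b.HasLabel τ) :
    ∀ α ∈ τ, ∃ φ ∈ C, φ.StartsWith α := by
  intro α hα
  obtain ⟨σ, ρ, rfl⟩ := List.append_of_mem hα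
  refine (h.parent σ α (h.hasLabel_of_append _ ρ ?_)).2
  simpa using hτ

/-- A set that contains all labelled formulas of all branches that are coherent for `C`. -/
def formUniverse (C : Set (Form P)) : Set (LForm P) :=
  {τ | τ.length ≤ (𝒫 C).ncard ∧ ∀ α ∈ τ, ∃ φ ∈ C, φ.StartsWith α} ×ˢ C

theorem formUniverse_finite {C : Set (Form P)} (hC : C.Finite) : (formUniverse C).Finite := by
  refine Set.Finite.prod ?_ hC
  have hA : {α : Assignment P | ∃ φ ∈ C, φ.StartsWith α}.Finite := by
    have : {α : Assignment P | ∃ φ ∈ C, φ.StartsWith α} =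
        ⋃ φ ∈ C, {α | φ.StartsWith α} := by
      ext; simp
    rw [this]
    refine hC.biUnion fun φ _ => Set.Subsingleton.finite ?_
    rintro α ⟨ψ, h | h⟩ β ⟨χ, h' | h'⟩ <;> subst h <;> cases h' <;> rfl
  have := hA.to_subtype
  refine ((List.finite_length_le {α : Assignment P | ∃ φ ∈ C, φ.StartsWith α}
    (𝒫 C).ncard).image (List.map Subtype.val)).subset ?_
  rintro τ ⟨hlen, hmem⟩
  exact ⟨τ.attach.map fun α => ⟨α.1, hmem _ α.2⟩,
    show List.length _ ≤ _ by simpa using hlen, by simp⟩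

theorem Branch.Coherent.forms_subset {C : Set (Form P)} (hC : C.Finite) {b : Branch P}
    (h : b.Coherent C) : b.forms ⊆ formUniverse C := fun _ hl =>
  ⟨⟨h.length_le hC ⟨_, hl⟩, h.mem_label ⟨_, hl⟩⟩, h.mem_closure _ hl⟩

/-- The formulas `S` can be installed in `b` as a new successor `σα` of `σ`. -/
structure Branch.CreateReady (C : Set (Form P)) (b : Branch P) (σ : Label P) (α : Assignment P)
    (S : Set (LForm P)) : Prop where
  hasLabel : b.HasLabel σ
  not_hasLabel : ¬ b.HasLabel (σ ++ [α])
  startsWith : ∃ φ ∈ C, φ.StartsWith α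
  not_single : ¬ b.HasApplicable singleRules σ
  not_split : ¬ b.HasApplicable splitRules σ
  eq_of_formsAt : ∀ τ, b.HasLabel τ → b.formsAt σ = b.formsAt τ → τ = σ
  label_eq : ∀ m ∈ S, m.1 = σ ++ [α]
  mem_closure : ∀ m ∈ S, m.2 ∈ C

theorem Branch.HasApplicable.of_mark {b : Branch P} {R : Set Rule} {σ : Label P}
    {S : Set (LForm P)} (h : (b.mark S).HasApplicable R σ) : b.HasApplicable R σ := by
  obtain ⟨ρ, hρ, φ, bs, hg, hm⟩ := h
  exact ⟨ρ, hρ, φ, bs, hg, fun hm' => hm (.inl hm')⟩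

theorem Branch.CreateReady.mark {C : Set (Form P)} {b : Branch P} {σ : Label P} {α : Assignment P}
    {S : Set (LForm P)} (h : b.CreateReady C σ α S) (M : Set (LForm P)) :
    (b.mark M).CreateReady C σ α S where
  hasLabel := h.hasLabel
  not_hasLabel := h.not_hasLabel
  startsWith := h.startsWith
  not_single := fun h' => h.not_single h'.of_mark
  not_split := fun h' => h.not_split h'.of_mark
  eq_of_formsAt := h.eq_of_formsAt
  label_eq := h.label_eq
  mem_closure := h.mem_closure

theorem Branch.CreateReady.union {C : Set (Form P)} {b : Branch P} {σ : Label P} {α : Assignment P}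
    {S S' : Set (LForm P)} (h : b.CreateReady C σ α S) (hl : ∀ m ∈ S', m.1 = σ ++ [α])
    (hC : ∀ m ∈ S', m.2 ∈ C) : b.CreateReady C σ α (S ∪ S') where
  __ := h
  label_eq := fun m hm => hm.elim (h.label_eq m) (hl m)
  mem_closure := fun m hm => hm.elim (h.mem_closure m) (hC m)

/-- Formulas may be added at a label `τ` without successors if `τ` is a label already, or if it is a
new successor of a label `σ` that becomes settled and differs in its formulas from all others.
No label with a successor gains a formula, so the properties of those labels persist. -/
theorem Branch.Coherent.extend {C : Set (Form P)} {b : Branch P} (h : b.Coherent C)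
    {τ : Label P} {S : Set (LForm P)} (hl : ∀ m ∈ S, m.1 = τ) (hC : ∀ m ∈ S, m.2 ∈ C)
    (hτ : ∀ α, ¬ b.HasLabel (τ ++ [α]))
    (hnew : b.HasLabel τ ∨ ∃ σ α, τ = σ ++ [α] ∧ b.HasLabel σ ∧
      (∃ φ ∈ C, φ.StartsWith α) ∧ (∀ σ', b.HasLabel σ' → b.formsAt σ = b.formsAt σ' → σ' = σ) ∧
      ∀ ρ φ bs, Generates ρ (b.forms ∪ S) (σ, φ) bs → (σ, φ) ∉ b.marked →
        ρ ∈ assignRules ∧ ¬ φ.StartsWith α) :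
    (b.extend S).Coherent C := by
  have hlab : ∀ σ, (b.extend S).HasLabel σ → b.HasLabel σ ∨ σ = τ := by
    rintro σ ⟨φ, hφ | hφ⟩
    · exact .inl ⟨φ, hφ⟩
    · exact .inr (hl _ hφ)
  have hmono : ∀ σ, b.HasLabel σ → (b.extend S).HasLabel σ := fun σ ⟨φ, hφ⟩ => ⟨φ, .inl hφ⟩
  have hne : ∀ σ α, (b.extend S).HasLabel (σ ++ [α]) → σ ≠ τ := by
    rintro σ α hσ rfl
    rcases hlab _ hσ with h' | h'
    · exact hτ _ h'
    · simp at h'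
  have hold : ∀ σ φ, σ ≠ τ → (σ, φ) ∈ (b.extend S).forms → (σ, φ) ∈ b.forms := by
    rintro σ φ hσ (h' | h')
    · exact h'
    · exact absurd (hl _ h') hσ
  have hforms : ∀ σ, σ ≠ τ → (b.extend S).formsAt σ = b.formsAt σ := fun σ hσ =>
    Set.ext fun φ => ⟨hold σ φ hσ, .inl⟩
  refine ⟨?_, ?_, ?_, ?_⟩
  · rintro l (hl' | hl')
    · exact h.mem_closure _ hl'
    · exact hC _ hl'
  · intro σ α hσ
    rcases hlab _ hσ with h' | h'
    · exact ⟨hmono _ (h.parent _ _ h').1, (h.parent _ _ h').2⟩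
    · rcases hnew with h'' | ⟨σ', α', rfl, h₁, h₂, -⟩
      · rw [← h'] at h''
        exact ⟨hmono _ (h.parent _ _ h'').1, (h.parent _ _ h'').2⟩
      · obtain ⟨rfl, rfl⟩ : σ = σ' ∧ α = α' := by simpa using h'
        exact ⟨hmono _ h₁, h₂⟩
  · intro σ α ρ φ bs hσ hg hm
    have hmem := hold _ _ (hne _ _ hσ) hg.witness_mem
    -- If all successors of `σ` are old, its applicable witnesses are those that it has in `b`.
    have key : (∀ β, (b.extend S).HasLabel (σ ++ [β]) → b.HasLabel (σ ++ [β])) →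
        ρ ∈ assignRules ∧ ¬ φ.StartsWith α := fun hs =>
      h.settled σ α ρ φ bs (hs _ hσ) (hg.transfer hmem fun _ β ψ hβ => hs β ⟨ψ, hβ⟩) hm
    rcases hnew with hτ' | ⟨σ', α', rfl, -, -, -, hg'⟩
    · exact key fun β hβ => (hlab _ hβ).elim id fun e => e ▸ hτ'
    · by_cases hσ' : σ = σ'
      · subst hσ'
        obtain ⟨h₁, h₂⟩ := hg' ρ φ bs hg hm
        rcases hlab _ hσ with h' | h'
        · exact h.settled σ α ρ φ bs h'
            (hg.transfer hmem fun hp => absurd h₁ (not_assignRules_of_prop hp)) hm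
        · obtain rfl : α = α' := by simpa using h'
          exact ⟨h₁, h₂⟩
      · refine key fun β hβ => (hlab _ hβ).elim id fun e => ?_
        exact absurd (by simpa using e : σ = σ' ∧ β = α').1 hσ'
  · intro σ α σ' α' hσ hσ' heq
    rw [hforms _ (hne _ _ hσ), hforms _ (hne _ _ hσ')] at heq
    rcases hnew with h' | ⟨σ₀, α₀, rfl, -, -, hd, -⟩
    · exact h.formsAt_inj σ α σ' α' ((hlab _ hσ).elim id fun e => e ▸ h')
        ((hlab _ hσ').elim id fun e => e ▸ h') heq
    · have hcases : ∀ σ α, (b.extend S).HasLabel (σ ++ [α]) →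
          b.HasLabel (σ ++ [α]) ∨ σ = σ₀ := fun σ α hσ =>
        (hlab _ hσ).imp id fun e => (by simpa using e : σ = σ₀ ∧ α = α₀).1
      rcases hcases _ _ hσ with h₁ | rfl <;> rcases hcases _ _ hσ' with h₂ | rfl
      · exact h.formsAt_inj σ α σ' α' h₁ h₂ heq
      · exact hd _ (h.parent _ _ h₁).1 heq.symm
      · exact (hd _ (h.parent _ _ h₂).1 heq).symm
      · rfl

/-- A label with an applicable local rule has no successors, so the rule may be applied. -/
theorem Branch.Coherent.extend_local {C : Set (Form P)} (hC : RuleClosed C) {b : Branch P}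
    (h : b.Coherent C) {ρ σ φ bs} (hρ : ρ ∈ singleRules ∨ ρ ∈ splitRules)
    (hg : Generates ρ b.forms (σ, φ) bs) (hm : (σ, φ) ∉ b.marked) {c} (hc : c ∈ bs)
    (M : Set (LForm P)) : ((b.mark M).extend c).Coherent C := by
  refine (h.mark M).extend (τ := σ) (hg.label_eq hρ c hc)
    (hC _ _ _ _ hg (h.mem_closure _ hg.witness_mem) c hc) ?_ (.inl ⟨φ, hg.witness_mem⟩)
  intro α hα
  have := (h.settled σ α ρ φ bs hα hg hm).1
  exact hρ.elim (fun h' => not_assignRules_of_single h' this)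
    fun h' => not_assignRules_of_split h' this

theorem Branch.Coherent.extend_create {C : Set (Form P)} {b : Branch P}
    (h : b.Coherent C) {σ α S} (hS : b.CreateReady C σ α S)
    (hcollect : ¬ ∃ ρ ∈ assignRules, ∃ φ c, φ.StartsWith α ∧
      Generates ρ b.forms (σ, φ) [c] ∧ (σ, φ) ∉ b.marked)
    (hprop : ¬ ∃ ρ ∈ propRules, ∃ l c, Generates ρ (b.forms ∪ S) l [c] ∧ l ∉ b.marked) :
    (b.extend S).Coherent C := by
  refine h.extend (τ := σ ++ [α]) hS.label_eq hS.mem_closure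
    (fun β hβ => hS.not_hasLabel (h.parent _ _ hβ).1)
    (.inr ⟨σ, α, rfl, hS.hasLabel, hS.startsWith, hS.eq_of_formsAt, ?_⟩)
  intro ρ φ bs hg hm
  have hmem : (σ, φ) ∈ b.forms := by
    rcases hg.witness_mem with h' | h'
    · exact h'
    · simpa using hS.label_eq _ h'
  rcases hg.rule_cases with hρ | hρ | hρ | hρ
  · exact absurd ⟨ρ, hρ, φ, bs, hg.transfer hmem
      fun hp => absurd hp (not_propRules_of_single hρ), hm⟩ hS.not_single
  · exact absurd ⟨ρ, hρ, φ, bs, hg.transfer hmem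
      fun hp => absurd hp (not_propRules_of_split hρ), hm⟩ hS.not_split
  · refine ⟨hρ, fun hφ => ?_⟩
    obtain ⟨c, rfl⟩ := hg.eq_singleton (not_splitRules_of_assign hρ)
    exact hcollect ⟨ρ, hρ, φ, c, hφ, hg.transfer hmem
      fun hp => absurd hρ (not_assignRules_of_prop hp), hm⟩
  · obtain ⟨c, rfl⟩ := hg.eq_singleton (not_splitRules_of_prop hρ)
    exact absurd ⟨ρ, hρ, _, c, hg, hm⟩ hprop

/-- While the new successor `σα` is being prepared, the propagation rules only copy literals from
`σ` to `σα`. -/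
theorem Branch.CreateReady.propagate {C : Set (Form P)} {b : Branch P} (h : b.Coherent C)
    {σ α S} (hS : b.CreateReady C σ α S) {ρ l c} (hρ : ρ ∈ propRules)
    (hg : Generates ρ (b.forms ∪ S) l [c]) (hm : l ∉ b.marked) :
    l ∈ b.forms ∧ b.CreateReady C σ α (S ∪ c) := by
  obtain ⟨τ, φ⟩ := l
  obtain ⟨β, ψ, hψ, hc, hb⟩ := hg.of_propRules hρ
  obtain rfl : c = {(τ ++ [β], φ)} := by simpa using hc
  have hτ : τ ≠ σ ++ [α] := by
    rintro rfl
    rcases hψ with h' | h'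
    · exact hS.not_hasLabel (h.parent _ _ ⟨_, h'⟩).1
    · simpa using hS.label_eq _ h'
  have hmem : (τ, φ) ∈ b.forms := by
    rcases hg.witness_mem with h' | h'
    · exact h'
    · exact absurd (hS.label_eq _ h') hτ
  refine ⟨hmem, hS.union ?_ ?_⟩
  · rintro _ rfl
    by_contra hne
    rcases hψ with h' | h'
    · exact not_assignRules_of_prop hρ
        (h.settled τ β ρ φ _ ⟨_, h'⟩ (hb _ _ hmem h') hm).1
    · exact hne (hS.label_eq (τ ++ [β], ψ) h')
  · rintro _ rfl
    exact h.mem_closure (τ, φ) hmem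

/-! ### The weight of a tableau -/

/-- The number of labelled formulas in `U` that are not marked in `b`. -/
noncomputable def Branch.unmarkedCount (U : Set (LForm P)) (b : Branch P) : ℕ :=
  (U \ b.marked).ncard

/-- The sum of `3 ^ n` over the branches, where `n` counts unmarked formulas. With base `3`, two
branches with a smaller `n` weigh less than one. -/
noncomputable def Tableau.weight (U : Set (LForm P)) (T : Tableau P) : ℕ :=
  ∑ᶠ b ∈ T, 3 ^ b.unmarkedCount U

theorem Branch.unmarkedCount_lt {U : Set (LForm P)} (hU : U.Finite) {b b' : Branch P}
    {l : LForm P} (hl : l ∈ U) (hm : l ∉ b.marked) (hsub : b.marked ⊆ b'.marked)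
    (hl' : l ∈ b'.marked) : b'.unmarkedCount U < b.unmarkedCount U := by
  refine Set.ncard_lt_ncard ⟨Set.sdiff_subset_sdiff_right hsub, fun h => ?_⟩ hU.sdiff
  exact (h ⟨hl, hm⟩).2 hl'

theorem Tableau.weight_replace_add_le (U : Set (LForm P)) {T : Tableau P} (hT : T.Finite)
    {b : Branch P} (hb : b ∈ T) {B : Set (Branch P)} (hB : B.Finite) :
    (T.replace b B).weight U + 3 ^ b.unmarkedCount U ≤ T.weight U + Tableau.weight U B := by
  have h₁ := finsum_mem_union_inter (f := fun b : Branch P => 3 ^ b.unmarkedCount U)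
    (hT.sdiff (t := {b})) hB
  have h₂ := finsum_mem_insert (fun b : Branch P => 3 ^ b.unmarkedCount U)
    (a := b) (s := T \ {b}) (by simp) hT.sdiff
  rw [Set.insert_sdiff_singleton, Set.insert_eq_of_mem hb] at h₂
  simp only [Tableau.weight, Tableau.replace] at *
  omega

theorem Tableau.weight_singleton (U : Set (LForm P)) (b : Branch P) :
    Tableau.weight U {b} = 3 ^ b.unmarkedCount U := by
  simp [Tableau.weight]

theorem Tableau.weight_pair_le (U : Set (LForm P)) (b c : Branch P) :
    Tableau.weight U {b, c} ≤ 3 ^ b.unmarkedCount U + 3 ^ c.unmarkedCount U := by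
  by_cases h : b = c
  · subst h
    simp [Tableau.weight]
  · exact (finsum_mem_pair h).le

theorem Tableau.weight_replace_le (U : Set (LForm P)) {T : Tableau P} (hT : T.Finite)
    {b b' : Branch P} (hb : b ∈ T) (h : b'.marked = b.marked) :
    (T.replace b {b'}).weight U ≤ T.weight U := by
  have := weight_replace_add_le U hT hb (Set.finite_singleton b')
  rw [weight_singleton, show b'.unmarkedCount U = b.unmarkedCount U by
    simp [Branch.unmarkedCount, h]] at this
  omega

theorem Tableau.weight_replace_lt {U : Set (LForm P)} {T : Tableau P} (hT : T.Finite)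
    {b b' : Branch P} (hb : b ∈ T) (h : b'.unmarkedCount U < b.unmarkedCount U) :
    (T.replace b {b'}).weight U < T.weight U := by
  have h₁ := weight_replace_add_le U hT hb (Set.finite_singleton b')
  have h₂ := Nat.pow_lt_pow_right (a := 3) (by norm_num) h
  rw [weight_singleton] at h₁
  omega

theorem Tableau.weight_replace_pair_lt {U : Set (LForm P)} {T : Tableau P} (hT : T.Finite)
    {b c c' : Branch P} (hb : b ∈ T) (h : c.unmarkedCount U < b.unmarkedCount U)
    (h' : c'.unmarkedCount U < b.unmarkedCount U) :
    (T.replace b {c, c'}).weight U < T.weight U := by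
  have h₁ := weight_replace_add_le U hT hb (Set.toFinite {c, c'})
  have h₂ := weight_pair_le U c c'
  have h₃ := Nat.pow_le_pow_right (n := 3) (by norm_num) h
  have h₄ := Nat.pow_le_pow_right (n := 3) (by norm_num) h'
  have h₅ := Nat.pow_pos (n := c.unmarkedCount U) (show 0 < 3 by norm_num)
  simp only [Nat.succ_eq_add_one, pow_succ] at h₃ h₄
  omega

/-! ### The invariant and the measure of a state -/

/-- A finite set of coherent branches. -/
def Tableau.Coherent (C : Set (Form P)) (T : Tableau P) : Prop :=
  T.Finite ∧ ∀ b ∈ T, b.Coherent C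

theorem Tableau.Coherent.replace {C : Set (Form P)} {T : Tableau P} (hT : T.Coherent C)
    (b : Branch P) {B : Set (Branch P)} (hB : B.Finite) (h : ∀ c ∈ B, c.Coherent C) :
    (T.replace b B).Coherent C :=
  ⟨hT.1.sdiff.union hB, fun c hc => hc.elim (fun hc => hT.2 c hc.1) (h c)⟩

theorem Tableau.Coherent.replace_singleton {C : Set (Form P)} {T : Tableau P} (hT : T.Coherent C)
    (b : Branch P) {b' : Branch P} (h : b'.Coherent C) :
    (T.replace b {b'}).Coherent C ∧ b' ∈ T.replace b {b'} :=
  ⟨hT.replace b (Set.finite_singleton _) (by rintro c rfl; exact h), .inr rfl⟩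

/-- The weight of the tableau of a state. -/
noncomputable def State.weight (U : Set (LForm P)) : State P → ℕ
  | .outer T => T.weight U
  | .inner T _ => T.weight U
  | .select T _ _ => T.weight U
  | .collect T _ _ _ _ => T.weight U
  | .propagate T _ _ => T.weight U
  | .returned _ => 0

open Classical in
/-- The position of a state among those that the algorithm can pass through without marking a
formula, counted from the end. A state `inner T b` comes before `outer T` if the inner loop is about
to be left, and after it if the body of that loop is about to be run. -/
noncomputable def State.rank : State P → ℕ
  | .collect _ _ _ _ _ => 6
  | .propagate _ _ _ => 5
  | .inner _ b => if b.Closed ∨ b.Saturated then 4 else 2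
  | .outer _ => 3
  | .select _ _ _ => 1
  | .returned _ => 0

/-- What holds whenever the algorithm is in the given state; `C` is the closure of the input
formula. -/
def State.Invariant (C : Set (Form P)) : State P → Prop
  | .outer T => T.Coherent C
  | .inner T b => T.Coherent C ∧ b ∈ T
  | .select T b σ => (T.Coherent C ∧ b ∈ T) ∧ b.HasLabel σ ∧ ¬ b.LabelSaturated σ
  | .collect T b σ α S => (T.Coherent C ∧ b ∈ T) ∧ b.CreateReady C σ α S
  | .propagate T b S => (T.Coherent C ∧ b ∈ T) ∧ ∃ σ α, b.CreateReady C σ α S ∧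
      ¬ ∃ ρ ∈ assignRules, ∃ φ c, φ.StartsWith α ∧ Generates ρ b.forms (σ, φ) [c] ∧
        (σ, φ) ∉ b.marked
  | .returned _ => True

theorem State.rank_le (s : State P) : s.rank ≤ 6 := by
  cases s <;> simp only [State.rank] <;> (try split_ifs) <;> omega

/-- The lexicographic order of weight and rank, as a natural number. -/
noncomputable def State.measure (U : Set (LForm P)) (s : State P) : ℕ := 7 * s.weight U + s.rank

theorem State.measure_lt_of_weight_lt {U : Set (LForm P)} {s t : State P}
    (h : t.weight U < s.weight U) : t.measure U < s.measure U := by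
  have := t.rank_le
  unfold State.measure
  omega

theorem State.measure_lt_of_rank_lt {U : Set (LForm P)} {s t : State P}
    (h : t.weight U ≤ s.weight U) (h' : t.rank < s.rank) : t.measure U < s.measure U := by
  unfold State.measure
  omega

theorem initialBranch_coherent (V : Set P) (φ₀ : Form P) :
    (initialBranch V φ₀).Coherent φ₀.tableauClosure := by
  have hlab : ∀ σ α, ¬ (initialBranch V φ₀).HasLabel (σ ++ [α]) := by
    rintro σ α ⟨φ, (⟨p, -, h⟩ | ⟨p, -, h⟩) | h⟩
    · simp at h
    · simp at h
    · simp at h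
  refine ⟨?_, fun σ α h => absurd h (hlab σ α), fun σ α _ _ _ h => absurd h (hlab σ α),
    fun σ α _ _ h => absurd h (hlab σ α)⟩
  rintro l ((⟨p, hp, rfl⟩ | ⟨p, hp, rfl⟩) | rfl)
  · exact .inl (.inr ⟨p, hp.1, rfl⟩)
  · exact .inr ⟨_, .inr ⟨p, hp.1, rfl⟩, rfl⟩
  · exact .inl (.inl φ₀.self_mem_closure)

theorem start_invariant (V : Set P) (φ₀ : Form P) :
    (start V φ₀).Invariant φ₀.tableauClosure :=
  ⟨Set.finite_singleton _, by rintro b rfl; exact initialBranch_coherent V φ₀⟩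

/-- An unsaturated label of a coherent branch always admits a case of the `if` cascade: a
propagation rule is never applicable between two iterations. -/
theorem Branch.Coherent.exists_applicable {C : Set (Form P)} {b : Branch P} (h : b.Coherent C)
    {σ : Label P} (hσ : ¬ b.LabelSaturated σ) :
    b.HasApplicable singleRules σ ∨ b.HasApplicable splitRules σ ∨
      b.HasApplicable assignRules σ := by
  simp only [Branch.LabelSaturated, not_forall] at hσ
  obtain ⟨ρ, φ, bs, hg, hm, -⟩ := hσ
  rcases hg.rule_cases with hρ | hρ | hρ | hρ
  · exact .inl ⟨ρ, hρ, φ, bs, hg, hm⟩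
  · exact .inr (.inl ⟨ρ, hρ, φ, bs, hg, hm⟩)
  · exact .inr (.inr ⟨ρ, hρ, φ, bs, hg, hm⟩)
  · obtain ⟨α, ψ, hψ, -⟩ := hg.of_propRules hρ
    exact absurd (h.settled σ α ρ φ bs ⟨ψ, hψ⟩ hg hm).1 (not_assignRules_of_prop hρ)

/-- Every step preserves the invariant and decreases the measure. -/
theorem Step.invariant_and_measure_lt {C : Set (Form P)} (hfin : C.Finite) (hC : RuleClosed C)
    {s t : State P} (hst : Step s t) (hs : s.Invariant C) :
    t.Invariant C ∧ t.measure (formUniverse C) < s.measure (formUniverse C) := by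
  have hU := formUniverse_finite hfin
  -- Marking an unmarked formula of a branch lowers the count of that branch.
  have hlt : ∀ {b b' : Branch P} {l}, b.Coherent C → l ∈ b.forms → l ∉ b.marked →
      b.marked ∪ {l} ⊆ b'.marked →
      b'.unmarkedCount (formUniverse C) < b.unmarkedCount (formUniverse C) :=
    fun hb hl hm hsub => Branch.unmarkedCount_lt hU (hb.forms_subset hfin hl) hm
      (Set.subset_union_left.trans hsub) (hsub (.inr rfl))
  cases hst with
  | pickBranch hb hc hsat =>
    refine ⟨⟨hs, hb⟩, State.measure_lt_of_rank_lt le_rfl ?_⟩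
    simp [State.rank, hc, hsat]
  | returnTrue _ _ =>
    exact ⟨trivial, State.measure_lt_of_rank_lt (Nat.zero_le _) (by simp [State.rank])⟩
  | returnFalse _ _ =>
    exact ⟨trivial, State.measure_lt_of_rank_lt (Nat.zero_le _) (by simp [State.rank])⟩
  | pickLabel hc hsat hσ _ hσ' =>
    refine ⟨⟨hs, hσ, hσ'⟩, State.measure_lt_of_rank_lt le_rfl ?_⟩
    simp [State.rank, hc, hsat]
  | leaveInner h =>
    refine ⟨hs.1, State.measure_lt_of_rank_lt le_rfl ?_⟩
    simp [State.rank, h]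
  | single hρ hg hm hb' =>
    obtain ⟨⟨hT, hb⟩, -⟩ := hs
    subst hb'
    exact ⟨hT.replace_singleton _
        ((hT.2 _ hb).extend_local hC (.inl hρ) hg hm (by simp) _),
      State.measure_lt_of_weight_lt (Tableau.weight_replace_lt hT.1 hb
        (hlt (hT.2 _ hb) hg.witness_mem hm subset_rfl))⟩
  | split _ hρ hg hm hc₁ hc₂ hb' =>
    obtain ⟨⟨hT, hb⟩, -⟩ := hs
    subst hc₁ hc₂
    refine ⟨⟨hT.replace _ (Set.toFinite _) ?_, .inr hb'⟩,
      State.measure_lt_of_weight_lt (Tableau.weight_replace_pair_lt hT.1 hb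
        (hlt (hT.2 _ hb) hg.witness_mem hm subset_rfl)
        (hlt (hT.2 _ hb) hg.witness_mem hm subset_rfl))⟩
    rintro c (rfl | rfl)
    · exact (hT.2 _ hb).extend_local hC (.inr hρ) hg hm (by simp) _
    · exact (hT.2 _ hb).extend_local hC (.inr hρ) hg hm (by simp) _
  | equalClosed _ _ _ _ hb' hT' _ =>
    obtain ⟨⟨hT, hb⟩, hσ, hsat⟩ := hs
    subst hb' hT'
    simp only [Branch.LabelSaturated, not_forall] at hsat
    obtain ⟨ρ, φ, bs, hg, hm, -⟩ := hsat
    obtain ⟨h₁, h₂⟩ := hT.replace_singleton _ ((hT.2 _ hb).mark _)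
    refine ⟨h₁.replace_singleton _ (((hT.2 _ hb).mark _).closeAt _),
      State.measure_lt_of_weight_lt (lt_of_le_of_lt (Tableau.weight_replace_le _ h₁.1 h₂ ?_)
        (Tableau.weight_replace_lt hT.1 hb (hlt (hT.2 _ hb) hg.witness_mem hm ?_)))⟩
    · rfl
    exact Set.union_subset_union_right _ (by rintro _ rfl; exact ⟨hg.witness_mem, rfl⟩)
  | equalOpen _ _ _ _ hb' hT' _ =>
    obtain ⟨⟨hT, hb⟩, hσ, hsat⟩ := hs
    subst hb' hT'
    simp only [Branch.LabelSaturated, not_forall] at hsat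
    obtain ⟨ρ, φ, bs, hg, hm, -⟩ := hsat
    refine ⟨hT.replace_singleton _ ((hT.2 _ hb).mark _),
      State.measure_lt_of_weight_lt
        (Tableau.weight_replace_lt hT.1 hb (hlt (hT.2 _ hb) hg.witness_mem hm ?_))⟩
    exact Set.union_subset_union_right _ (by rintro _ rfl; exact ⟨hg.witness_mem, rfl⟩)
  | @create T b σ ρ φ α S b' h₁ h₂ heq hρ hφ hg hm hb' =>
    obtain ⟨⟨hT, hb⟩, hσ, -⟩ := hs
    subst hb'
    have hcoh := hT.2 _ hb
    have hφC := hcoh.mem_closure _ hg.witness_mem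
    refine ⟨⟨hT.replace_singleton _ (hcoh.mark _), Branch.CreateReady.mark ?_ _⟩,
      State.measure_lt_of_weight_lt (Tableau.weight_replace_lt hT.1 hb
        (hlt hcoh hg.witness_mem hm subset_rfl))⟩
    refine ⟨hσ, fun h => (hcoh.settled σ α ρ φ _ h hg hm).2 hφ, ⟨φ, hφC, hφ⟩, h₁, h₂, ?_,
      hg.label_eq_of_startsWith hρ hφ S (by simp), hC _ _ _ _ hg hφC S (by simp)⟩
    intro τ hτ he
    by_contra hne
    exact heq ⟨τ, hne, b, hb, hτ, b, hb, hσ, he⟩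
  | noCase h₁ h₂ _ h₃ =>
    obtain ⟨⟨hT, hb⟩, -, hsat⟩ := hs
    rcases (hT.2 _ hb).exists_applicable hsat with h | h | h
    · exact absurd h h₁
    · exact absurd h h₂
    · exact absurd h h₃
  | collectStep hρ hφ hg hm hb' =>
    obtain ⟨⟨hT, hb⟩, hr⟩ := hs
    subst hb'
    have hcoh := hT.2 _ hb
    exact ⟨⟨hT.replace_singleton _ (hcoh.mark _), (hr.union
        (hg.label_eq_of_startsWith hρ hφ _ (by simp))
        (hC _ _ _ _ hg (hcoh.mem_closure _ hg.witness_mem) _ (by simp))).mark _⟩,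
      State.measure_lt_of_weight_lt (Tableau.weight_replace_lt hT.1 hb
        (hlt hcoh hg.witness_mem hm subset_rfl))⟩
  | collectEnd h =>
    exact ⟨⟨hs.1, _, _, hs.2, h⟩, State.measure_lt_of_rank_lt le_rfl (by simp [State.rank])⟩
  | propagateStep hρ hg hm hb' =>
    obtain ⟨⟨hT, hb⟩, σ, α, hr, hcol⟩ := hs
    subst hb'
    have hcoh := hT.2 _ hb
    obtain ⟨hl, hr'⟩ := hr.propagate hcoh hρ hg hm
    refine ⟨⟨hT.replace_singleton _ (hcoh.mark _), σ, α, hr'.mark _, ?_⟩,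
      State.measure_lt_of_weight_lt (Tableau.weight_replace_lt hT.1 hb
        (hlt hcoh hl hm subset_rfl))⟩
    rintro ⟨ρ, hρ, φ, c, h₁, h₂, h₃⟩
    exact hcol ⟨ρ, hρ, φ, c, h₁, h₂, fun h => h₃ (.inl h)⟩
  | propagateEnd hprop hb' =>
    obtain ⟨⟨hT, hb⟩, σ, α, hr, hcol⟩ := hs
    subst hb'
    refine ⟨hT.replace_singleton _ ((hT.2 _ hb).extend_create hr hcol hprop),
      State.measure_lt_of_rank_lt (Tableau.weight_replace_le _ hT.1 hb rfl) ?_⟩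
    simp only [State.rank]
    split_ifs <;> omega

/-! ### Progress -/

/-- Every state in which the algorithm has not returned allows a step. -/
theorem exists_step (s : State P) (hs : ∀ a, s ≠ .returned a) : ∃ t, Step s t := by
  cases s with
  | outer T =>
    by_cases h : ∀ b ∈ T, b.Closed ∨ b.Saturated
    · by_cases h' : ∃ b ∈ T, ¬ b.Closed
      · exact ⟨_, .returnTrue h h'⟩
      · exact ⟨_, .returnFalse h (by simpa using h')⟩
    · push Not at h
      obtain ⟨b, hb, h₁, h₂⟩ := h
      exact ⟨_, .pickBranch hb h₁ h₂⟩
  | inner T b =>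
    by_cases h : b.Closed ∨ b.Saturated
    · exact ⟨_, .leaveInner h⟩
    · push Not at h
      obtain ⟨h₁, h₂⟩ := h
      have ⟨σ, hσ⟩ := not_forall.1 h₂
      obtain ⟨hl, hs⟩ := Classical.not_imp.1 hσ
      exact ⟨_, .pickLabel h₁ h₂ hl (fun h => h₁ ⟨σ, h⟩) hs⟩
  | select T b σ =>
    by_cases h₁ : b.HasApplicable singleRules σ
    · obtain ⟨ρ, hρ, φ, bs, hg, hm⟩ := h₁
      obtain ⟨c, rfl⟩ := hg.eq_singleton (not_splitRules_of_single hρ)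
      exact ⟨_, .single hρ hg hm rfl⟩
    by_cases h₂ : b.HasApplicable splitRules σ
    · obtain ⟨ρ, hρ, φ, bs, hg, hm⟩ := h₂
      obtain ⟨c₁, c₂, rfl⟩ := hg.eq_pair hρ
      exact ⟨_, .split h₁ hρ hg hm rfl rfl (.inl rfl)⟩
    by_cases h₃ : T.HasEqual σ
    · obtain ⟨σ', hne, he⟩ := h₃
      by_cases h₄ : ∃ c, (T.replace b {b.mark {l | l ∈ b.forms ∧ l.1 = σ}}).EqualVia σ σ' c ∧
          c.LabelClosed σ'
      · exact ⟨_, .equalClosed h₁ h₂ hne he rfl rfl h₄⟩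
      · exact ⟨_, .equalOpen h₁ h₂ hne he rfl rfl h₄⟩
    by_cases h₄ : b.HasApplicable assignRules σ
    · obtain ⟨ρ, hρ, φ, bs, hg, hm⟩ := h₄
      obtain ⟨c, rfl⟩ := hg.eq_singleton (not_splitRules_of_assign hρ)
      obtain ⟨α, hφ⟩ := hg.startsWith hρ
      exact ⟨_, .create h₁ h₂ h₃ hρ hφ hg hm rfl⟩
    · exact ⟨_, .noCase h₁ h₂ h₃ h₄⟩
  | collect T b σ α S =>
    by_cases h : ∃ ρ ∈ assignRules, ∃ φ c, φ.StartsWith α ∧ Generates ρ b.forms (σ, φ) [c] ∧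
        (σ, φ) ∉ b.marked
    · obtain ⟨ρ, hρ, φ, c, hφ, hg, hm⟩ := h
      exact ⟨_, .collectStep hρ hφ hg hm rfl⟩
    · exact ⟨_, .collectEnd h⟩
  | propagate T b S =>
    by_cases h : ∃ ρ ∈ propRules, ∃ l c, Generates ρ (b.forms ∪ S) l [c] ∧ l ∉ b.marked
    · obtain ⟨ρ, hρ, l, c, hg, hm⟩ := h
      exact ⟨_, .propagateStep hρ hg hm rfl⟩
    · exact ⟨_, .propagateEnd h rfl⟩
  | returned a => exact absurd rfl (hs a)

end Termination

end DLPA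

theorem mainTheorem7 {P : Type*} (V : Set P) (φ₀ : DLPA.Form P) :
    (¬ ∃ run : ℕ → DLPA.State P,
      run 0 = DLPA.start V φ₀ ∧ ∀ n, DLPA.Step (run n) (run (n + 1))) ∧
    (∀ s, Relation.ReflTransGen DLPA.Step (DLPA.start V φ₀) s →
      (∀ t, ¬ DLPA.Step s t) → ∃ answer, s = .returned answer) := by
  refine ⟨?_, fun s _ hs => ?_⟩
  · rintro ⟨run, h₀, hrun⟩
    have hstep := fun n => (hrun n).invariant_and_measure_lt φ₀.tableauClosure_finite
      φ₀.ruleClosed_tableauClosure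
    have hinv : ∀ n, (run n).Invariant φ₀.tableauClosure := fun n => by
      induction n with
      | zero => exact h₀ ▸ DLPA.start_invariant V φ₀
      | succ n ih => exact (hstep n ih).1
    exact not_strictAnti_of_wellFoundedLT
      (fun n => (run n).measure (DLPA.formUniverse φ₀.tableauClosure))
      (strictAnti_nat_of_succ_lt fun n => (hstep n (hinv n)).2)
  · by_contra hne
    obtain ⟨t, ht⟩ := DLPA.exists_step s fun a ha => hne ⟨a, ha⟩
    exact hs t ht
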